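/- For positive integers $s_1,\dots,s_d\ge 2$ and signs $\varepsilon_1,\dots,\varepsilon_d\in\{1,-1\}$ let $$\zeta(s_1,\dots,s_d;\varepsilon_1,\dots,\varepsilon_d)=\sum_{n_1>\cdots>n_d\ge 1}\frac{\varepsilon_1^{n_1}\cdots\varepsilon_d^{n_d}}{n_1^{s_1}\cdots n_d^{s_d}},$$ and write $\zeta(s)=\zeta(s;1)=\sum_{k\ge1}k^{-s}$ and $\zeta(\overline{s})=\zeta(s;-1)=\sum_{k\ge1}(-1)^k k^{-s}$. For integers $n,d\ge 1$ and $0\le\alpha\le d$ let $$A_\alpha(2n,d)=\sum_{\substack{j_1+\cdots+j_d=n,\ j_1,\dots,j_d>0\\ \varepsilon\in\{1,-1\}^d,\ \sharp\{\ell:\varepsilon_\ell=-1\}=\alpha}}\zeta(2j_1,\dots,2j_d;\varepsilon_1,\dots,\varepsilon_d),\qquad A(2n,d)=\sum_{\alpha=0}^{d}A_\alpha(2n,d),$$ where an empty sum (the case $n<d$) is $0$. Then for every integer $n\ge 2$ (in particular for every $n\ge 4$, where the sums are non-empty) \begin{align*} A_1(2n,4)&=\tfrac{19}{16}\zeta(2n)+\zeta(\overline{2n})-\tfrac18\zeta(2)\zeta(2n-2),\\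 A_2(2n,4)&=\tfrac{57}{32}\zeta(2n)+\tfrac32\zeta(\overline{2n})-\tfrac3{16}\zeta(2)\zeta(2n-2),\\ A_3(2n,4)&=\tfrac{11}{16}\zeta(2n)+\tfrac32\zeta(\overline{2n})-\tfrac12\zeta(2)\zeta(\overline{2n-2}),\\ A_4(2n,4)&=\tfrac{11}{64}\zeta(2n)+\tfrac38\zeta(\overline{2n})-\tfrac18\zeta(2)\zeta(\overline{2n-2}), \end{align*} and for every integer $n\ge 3$ $$A(2n,4)=\frac{35}{4^{n+1}}\zeta(2n)-\frac{5}{4^n}\zeta(2)\zeta(2n-2).$$ -/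

import Mathlib

/-- Index tuples `n₁ > n₂ > ⋯ > n_d ≥ 1`. -/
abbrev DecreasingTuple (d : ℕ) : Type :=
  {m : Fin d → ℕ // StrictAnti m ∧ ∀ i, 0 < m i}

/-- The general term `∏ i, ε_i ^ n_i / n_i ^ s_i` of an alternating Euler sum. -/
noncomputable def eulerTerm {d : ℕ} (s : Fin d → ℕ) (ε : Fin d → ℤˣ)
    (m : DecreasingTuple d) : ℝ :=
  ∏ i, (((ε i : ℤ) : ℝ) ^ (m.1 i)) / ((m.1 i : ℝ) ^ (s i))

/-- The (alternating) Euler sum `ζ(s₁,…,s_d; ε₁,…,ε_d)`, with signs `ε_i ∈ {1, -1} = ℤˣ`.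
It is used here only for exponents `s_i ≥ 2`, where the series converges absolutely
(`summable_eulerTerm`). -/
noncomputable def eulerSum {d : ℕ} (s : Fin d → ℕ) (ε : Fin d → ℤˣ) : ℝ :=
  ∑' m : DecreasingTuple d, eulerTerm s ε m

/-- The depth-one value `ζ(s)`. -/
noncomputable def zetaVal (s : ℕ) : ℝ := eulerSum (fun _ : Fin 1 => s) (fun _ => 1)

/-- The depth-one alternating value `ζ(s̄) = ∑ (-1)^k / k^s`. -/
noncomputable def zetaBar (s : ℕ) : ℝ := eulerSum (fun _ : Fin 1 => s) (fun _ => -1)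

/-- Tuples `(j₁,…,j_d)` of positive integers with sum `n`. -/
def positiveTuples (n d : ℕ) : Finset (Fin d → ℕ) :=
  (Finset.Nat.antidiagonalTuple d n).filter (fun j => ∀ i, 0 < j i)

/-- Sign vectors of length `d` with exactly `α` entries equal to `-1`. -/
def signVectors (α d : ℕ) : Finset (Fin d → ℤˣ) :=
  Finset.univ.filter (fun ε => (Finset.univ.filter (fun i => ε i = -1)).card = α)

/-- `A_α(2n, d)`: the sum of all Euler sums of weight `2n` and depth `d` with even arguments
`2j₁,…,2j_d` and exactly `α` alternating components. -/
noncomputable def restrictedSum (α n d : ℕ) : ℝ :=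
  ∑ j ∈ positiveTuples n d, ∑ ε ∈ signVectors α d, eulerSum (fun i => 2 * j i) ε

/-- `A(2n, d)`: the sum of all alternating Euler sums of weight `2n` and depth `d` with even
arguments. -/
noncomputable def restrictedSumAll (n d : ℕ) : ℝ :=
  ∑ α ∈ Finset.range (d + 1), restrictedSum α n d

theorem summable_pi_prod_of_nonneg {f : ℕ → ℝ} (hf : Summable f) (h0 : ∀ n, 0 ≤ f n) (d : ℕ) :
    Summable (fun m : Fin d → ℕ => ∏ i, f (m i)) := by
  induction d with
  | zero => exact Summable.of_finite
  | succ d ih =>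
    have h := hf.mul_of_nonneg ih h0 (fun m => Finset.prod_nonneg fun i _ => h0 (m i))
    rw [← (Fin.consEquiv (fun _ : Fin (d + 1) => ℕ)).summable_iff]
    refine h.congr fun p => ?_
    simp [Fin.prod_univ_succ, Fin.consEquiv]

theorem summable_eulerTerm {d : ℕ} (s : Fin d → ℕ) (ε : Fin d → ℤˣ) (hs : ∀ i, 2 ≤ s i) :
    Summable (eulerTerm s ε) := by
  have h2 : Summable (fun k : ℕ => 1 / (k : ℝ) ^ 2) :=
    Real.summable_one_div_nat_pow.mpr one_lt_two
  have h := (summable_pi_prod_of_nonneg h2 (fun n => by positivity) d).comp_injective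
    (Subtype.val_injective (p := fun m : Fin d → ℕ => StrictAnti m ∧ ∀ i, 0 < m i))
  refine Summable.of_norm_bounded h fun m => ?_
  simp only [eulerTerm, norm_prod, Function.comp]
  refine Finset.prod_le_prod (fun i _ => norm_nonneg _) fun i _ => ?_
  have hm : (1 : ℝ) ≤ (m.1 i : ℝ) := by exact_mod_cast m.2.2 i
  have he : ‖((ε i : ℤ) : ℝ)‖ = 1 := by
    rcases Int.units_eq_one_or (ε i) with h | h <;> simp [h]
  rw [norm_div, norm_pow, norm_pow, he, one_pow, Real.norm_of_nonneg (by positivity)]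
  exact one_div_le_one_div_of_le (by positivity) (pow_le_pow_right₀ hm (hs i))

/-! Put V_m = ∑_{k≥1} (1 + w(-1)^m) X^k / m^(2k). Expanding a product of four V_m over n₁ > ⋯ > n₄
and over the signs shows that the coefficient of w^α X^n in e₄(V₁, V₂, …) is A_α(2n, 4). Newton's
formula reduces e₄ to the power sums of the V_m, taken separately over even and odd m.

With t² = π²X/4, the first power sums of the unweighted series are (1 - t cot t)/2 over even m and
(t tan t)/2 over odd m. A geometric series V = cX/(1 - cX) satisfies θV = V + V² for θ = X d/dX, so
applying θ yields the higher power sums. The Riccati equations of f = t cot t and g = t tan t keep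
these polynomial in f, g and u = t².

In e₄ the higher powers cancel and fg = u removes the mixed terms, leaving an expression linear in f
and g over polynomials in u (`tendsto_esymmSum_weightedTerm`). Its coefficients are ζ and ζ-bar
values at 2n, and, through u, multiples of ζ(2) times values at 2n-2. All limits are
coefficientwise, so convergence in t plays no role. -/

namespace AlternatingEulerSum

open PowerSeries Filter Topology
open scoped PowerSeries.WithPiTopology Nat

/-! ### The Euler operator and substitutions in power series. -/

/-- The Euler operator `f ↦ X f'` on formal power series. -/
noncomputable def eulerOp : Derivation ℝ ℝ⟦X⟧ ℝ⟦X⟧ := (X : ℝ⟦X⟧) • d⁄dX ℝ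

lemma eulerOp_apply (f : ℝ⟦X⟧) : eulerOp f = X * d⁄dX ℝ f := rfl

@[simp] lemma coeff_eulerOp (f : ℝ⟦X⟧) (n : ℕ) : coeff n (eulerOp f) = n * coeff n f := by
  rw [eulerOp_apply]
  cases n with
  | zero => simp
  | succ n => rw [coeff_succ_X_mul, coeff_derivative]; push_cast; ring

@[simp] lemma eulerOp_C (r : ℝ) : eulerOp (C r) = 0 := by simp [eulerOp_apply]

@[simp] lemma eulerOp_X : eulerOp (X : ℝ⟦X⟧) = X := by simp [eulerOp_apply]

lemma eulerOp_mul (f g : ℝ⟦X⟧) : eulerOp (f * g) = f * eulerOp g + g * eulerOp f := by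
  simp

lemma eulerOp_rescale (c : ℝ) (f : ℝ⟦X⟧) : eulerOp (rescale c f) = rescale c (eulerOp f) := by
  ext n; simp; ring

lemma eulerOp_expand_two (f : ℝ⟦X⟧) :
    eulerOp (expand 2 two_ne_zero f) = 2 * expand 2 two_ne_zero (eulerOp f) := by
  ext n
  rw [← map_ofNat (C (R := ℝ)) 2, coeff_C_mul, coeff_eulerOp, coeff_expand, coeff_expand]
  split_ifs with h
  · obtain ⟨k, rfl⟩ := h
    simp; ring
  · simp

lemma expand_two_injective :
    Function.Injective (expand 2 two_ne_zero : ℝ⟦X⟧ →ₐ[ℝ] ℝ⟦X⟧) := by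
  intro f g h
  ext n
  rw [← coeff_expand_mul 2 two_ne_zero f, h, coeff_expand_mul]

lemma rescale_const (a r : ℝ) : rescale a (C r : ℝ⟦X⟧) = C r := by
  ext n; rw [coeff_rescale, coeff_C]; split_ifs with h0 <;> simp [h0]

lemma expand_two_rescale (c : ℝ) (f : ℝ⟦X⟧) :
    expand 2 two_ne_zero (rescale (c ^ 2) f) = rescale c (expand 2 two_ne_zero f) := by
  ext n
  rw [coeff_rescale, coeff_expand, coeff_expand]
  split_ifs with h
  · obtain ⟨k, rfl⟩ := h
    simp [pow_mul]
  · simp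

/-! ### Riccati and duplication identities for the Bernoulli series. -/

lemma eulerOp_bernoulliPowerSeries :
    eulerOp (bernoulliPowerSeries ℝ) = bernoulliPowerSeries ℝ - X * bernoulliPowerSeries ℝ
      - bernoulliPowerSeries ℝ ^ 2 := by
  set B := bernoulliPowerSeries ℝ
  have h : B * (exp ℝ - 1) = X := bernoulliPowerSeries_mul_exp_sub_one ℝ
  have hd : B * exp ℝ + (exp ℝ - 1) * d⁄dX ℝ B = 1 := by
    have := congrArg (d⁄dX ℝ) h
    simpa [derivative_exp] using this
  rw [eulerOp_apply]
  linear_combination B * hd - (d⁄dX ℝ B + B) * h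

/-- Factoring e^(2z) - 1 = (e^z - 1)(e^z + 1) gives B(2z)(e^z + 1) = 2B(z); multiplying by B(z)
eliminates e^z. -/
lemma bernoulliPowerSeries_mul_rescale_two :
    rescale (2 : ℝ) (bernoulliPowerSeries ℝ) * (X + 2 * bernoulliPowerSeries ℝ)
      = 2 * bernoulliPowerSeries ℝ ^ 2 := by
  set B := bernoulliPowerSeries ℝ
  have h : B * (exp ℝ - 1) = X := bernoulliPowerSeries_mul_exp_sub_one ℝ
  have h2 : rescale (2 : ℝ) B * (exp ℝ ^ 2 - 1) = 2 * X := by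
    have := congrArg (rescale (2 : ℝ)) h
    rw [map_mul, map_sub, map_one, rescale_X, map_ofNat] at this
    rw [exp_pow_eq_rescale_exp]
    exact_mod_cast this
  have hne : exp ℝ - 1 ≠ 0 := by
    intro h0
    rw [h0, mul_zero] at h
    exact X_ne_zero h.symm
  have h3 : rescale (2 : ℝ) B * (exp ℝ + 1) = 2 * B := by
    apply mul_right_cancel₀ hne
    linear_combination h2 - 2 * h
  linear_combination B * h3 - rescale (2 : ℝ) B * h

/-- The even part `∑ B_{2k} / (2k)! X^k` of the Bernoulli series, as a series in the square of
the variable. -/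
noncomputable def evenBernoulli : ℝ⟦X⟧ :=
  mk fun k => ((bernoulli (2 * k) : ℝ) / ((2 * k)! : ℝ))

/-- B₁ = -1/2 is the only nonzero Bernoulli number of odd index. The series is (z/2) coth(z/2) in
the variable z². -/
lemma expand_evenBernoulli :
    expand 2 two_ne_zero evenBernoulli = bernoulliPowerSeries ℝ + C (1 / 2) * X := by
  ext n
  rw [coeff_expand, map_add, coeff_C_mul, coeff_X, evenBernoulli, bernoulliPowerSeries, coeff_mk,
    coeff_mk]
  split_ifs with h h1 h1
  · omega
  · obtain ⟨k, rfl⟩ := h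
    simp
  · subst h1; norm_num
  · have hodd : Odd n := Nat.not_even_iff_odd.mp fun he => h he.two_dvd
    rw [bernoulli_eq_zero_of_odd hodd (by have := hodd.pos; omega)]
    simp

lemma C_half_mul_two : (C (1 / 2 : ℝ) : ℝ⟦X⟧) * 2 = 1 := by
  rw [← map_ofNat (C (R := ℝ)) 2, ← map_mul]; norm_num

lemma eulerOp_evenBernoulli :
    2 * eulerOp evenBernoulli = evenBernoulli - evenBernoulli ^ 2 + C (1 / 4) * X := by
  apply expand_two_injective
  have h := eulerOp_expand_two evenBernoulli
  rw [expand_evenBernoulli, map_add, eulerOp_bernoulliPowerSeries, eulerOp_mul, eulerOp_C,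
    eulerOp_X] at h
  have h4 : (C (1 / 4 : ℝ) : ℝ⟦X⟧) = C (1 / 2) ^ 2 := by rw [← map_pow]; norm_num
  simp only [map_mul, map_add, map_sub, map_pow, map_ofNat, expand_C, expand_X,
    expand_evenBernoulli] at h ⊢
  rw [← h, h4]
  linear_combination X * bernoulliPowerSeries ℝ * C_half_mul_two

lemma evenBernoulli_mul_rescale_four :
    evenBernoulli * rescale 4 evenBernoulli = evenBernoulli ^ 2 + C (1 / 4) * X := by
  apply expand_two_injective
  have h := bernoulliPowerSeries_mul_rescale_two
  have h4 : (C (1 / 4 : ℝ) : ℝ⟦X⟧) = C (1 / 2) ^ 2 := by rw [← map_pow]; norm_num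
  have e4 : (4 : ℝ) = 2 ^ 2 := by norm_num
  simp only [map_mul, map_add, map_pow, expand_C, expand_X, expand_evenBernoulli]
  rw [e4, expand_two_rescale, expand_evenBernoulli, ← e4, h4, map_add, map_mul, rescale_X]
  rw [rescale_const, map_ofNat]
  have k := C_half_mul_two
  set c : ℝ⟦X⟧ := C (1 / 2)
  linear_combination c * h + (bernoulliPowerSeries ℝ ^ 2
    - rescale (2 : ℝ) (bernoulliPowerSeries ℝ) * bernoulliPowerSeries ℝ) * k

/-! ### The series t cot t and t tan t. -/

/-- The series `π² X / 4`. -/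
noncomputable def quarterPiSq : ℝ⟦X⟧ := C (Real.pi ^ 2 / 4) * X

/-- The expansion of `t cot t` in terms of `4 t² / π²`. -/
noncomputable def cotSeries : ℝ⟦X⟧ := rescale (-Real.pi ^ 2) evenBernoulli

/-- The expansion of `t tan t` in terms of `4 t² / π²`. -/
noncomputable def tanSeries : ℝ⟦X⟧ := cotSeries - rescale 4 cotSeries

lemma eulerOp_quarterPiSq : eulerOp quarterPiSq = quarterPiSq := by
  simp [quarterPiSq]

lemma eulerOp_cotSeries :
    2 * eulerOp cotSeries = cotSeries - cotSeries ^ 2 - quarterPiSq := by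
  have h := congrArg (rescale (-Real.pi ^ 2)) eulerOp_evenBernoulli
  simp only [map_mul, map_add, map_sub, map_pow, map_ofNat, rescale_const, rescale_X,
    ← eulerOp_rescale] at h
  rw [cotSeries, h, quarterPiSq, ← mul_assoc, ← map_mul, sub_eq_add_neg _ (_ * X), ← neg_mul,
    ← map_neg]
  ring_nf

/-- Scaling X by 4 doubles t, so this is 2 cot t cot 2t = cot² t - 1 multiplied by t². -/
lemma rescale_four_cotSeries_mul :
    cotSeries * rescale 4 cotSeries = cotSeries ^ 2 - quarterPiSq := by
  have h := congrArg (rescale (-Real.pi ^ 2)) evenBernoulli_mul_rescale_four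
  have hc : rescale (-Real.pi ^ 2) (rescale 4 evenBernoulli) = rescale 4 cotSeries := by
    rw [cotSeries, rescale_rescale, rescale_rescale, mul_comm]
  simp only [map_mul, map_add, map_pow, hc, rescale_const, rescale_X] at h
  rw [cotSeries] at h ⊢
  rw [h, quarterPiSq, ← mul_assoc, ← map_mul, sub_eq_add_neg _ (_ * X), ← neg_mul, ← map_neg]
  ring_nf

lemma cotSeries_mul_tanSeries : cotSeries * tanSeries = quarterPiSq := by
  rw [tanSeries]
  linear_combination -rescale_four_cotSeries_mul

lemma eulerOp_tanSeries :
    2 * eulerOp tanSeries = tanSeries + tanSeries ^ 2 + quarterPiSq := by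
  have h := congrArg (rescale 4) eulerOp_cotSeries
  simp only [map_mul, map_sub, map_pow, map_ofNat, ← eulerOp_rescale] at h
  have hu : rescale 4 quarterPiSq = 4 * quarterPiSq := by
    rw [quarterPiSq, map_mul, rescale_const, rescale_X, map_ofNat]; ring
  rw [hu] at h
  have h1 := cotSeries_mul_tanSeries
  rw [tanSeries] at h1 ⊢
  rw [map_sub]
  linear_combination eulerOp_cotSeries - h - 2 * h1

lemma constantCoeff_cotSeries : constantCoeff cotSeries = 1 := by
  simp [cotSeries, evenBernoulli, ← coeff_zero_eq_constantCoeff_apply, coeff_rescale]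

lemma hasSum_inv_even_pow (k : ℕ) (hk : k ≠ 0) :
    HasSum (fun m : ℕ => 1 / (m : ℝ) ^ (2 * k)) (-(4 ^ k * coeff k cotSeries) / 2) := by
  convert hasSum_zeta_nat hk using 1
  rw [cotSeries, coeff_rescale, evenBernoulli, coeff_mk]
  obtain ⟨j, rfl⟩ := Nat.exists_eq_succ_of_ne_zero hk
  have : 2 * (j + 1) - 1 = 2 * j + 1 := by omega
  rw [Nat.succ_eq_add_one, this]
  have e1 : (4 : ℝ) ^ (j + 1) = 2 ^ (2 * j + 1) * 2 := by
    rw [← pow_succ, show 2 * j + 1 + 1 = 2 * (j + 1) by ring, pow_mul]; norm_num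
  have e2 : (-Real.pi ^ 2) ^ (j + 1) = (-1) ^ (j + 1) * Real.pi ^ (2 * (j + 1)) := by
    rw [pow_mul, ← mul_pow]; ring
  rw [e1, e2]
  ring

/-! ### Geometric series and their power sums. -/

/-- The geometric series `c X / (1 - c X)`. -/
noncomputable def geomTerm (c : ℝ) : ℝ⟦X⟧ := mk fun k => if k = 0 then 0 else c ^ k

lemma coeff_geomTerm (c : ℝ) (k : ℕ) : coeff k (geomTerm c) = if k = 0 then 0 else c ^ k := by
  rw [geomTerm, coeff_mk]

lemma geomTerm_zero : geomTerm 0 = 0 := by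
  ext k; rw [coeff_geomTerm]; split_ifs with h <;> simp [h]

lemma one_sub_mul_geomTerm (c : ℝ) : (1 - C c * X) * geomTerm c = C c * X := by
  ext k
  rw [sub_mul, one_mul, map_sub, mul_assoc, coeff_C_mul, coeff_C_mul]
  cases k with
  | zero => simp [coeff_geomTerm]
  | succ k =>
    rw [coeff_succ_X_mul, coeff_geomTerm, coeff_geomTerm, coeff_X]
    rcases eq_or_ne k 0 with rfl | h
    · simp
    · simp [h]; ring

/-- Follows by applying θ to (1 - cX)V = cX and cancelling the nonzero factor (1 - cX)². -/
lemma eulerOp_geomTerm (c : ℝ) : eulerOp (geomTerm c) = geomTerm c + geomTerm c ^ 2 := by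
  have h := one_sub_mul_geomTerm c
  have hd := congrArg eulerOp h
  simp only [eulerOp_mul, map_sub, eulerOp_C, eulerOp_X, Derivation.map_one_eq_zero, mul_zero,
    add_zero, zero_sub] at hd
  have hne : (1 - C c * X : ℝ⟦X⟧) ≠ 0 := by
    intro h0
    simpa using congrArg constantCoeff h0
  apply mul_left_cancel₀ (mul_ne_zero hne hne)
  linear_combination (1 - C c * X) * hd + C c * X * h - (1 - C c * X) * h
    - ((1 - C c * X) * geomTerm c + C c * X) * h

lemma hasSum_eulerOp {ι : Type*} {V : ι → ℝ⟦X⟧} {P : ℝ⟦X⟧} (h : HasSum V P) :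
    HasSum (fun i => eulerOp (V i)) (eulerOp P) := by
  rw [WithPiTopology.hasSum_iff_hasSum_coeff] at h ⊢
  intro k
  simpa using (h k).mul_left (k : ℝ)

lemma hasSum_C_mul {ι : Type*} {V : ι → ℝ⟦X⟧} {P : ℝ⟦X⟧} (c : ℝ) (h : HasSum V P) :
    HasSum (fun i => C c * V i) (C c * P) := by
  rw [WithPiTopology.hasSum_iff_hasSum_coeff] at h ⊢
  intro k
  simpa using (h k).mul_left c

lemma hasSum_add {ι : Type*} {V W : ι → ℝ⟦X⟧} {P Q : ℝ⟦X⟧} (h : HasSum V P) (h' : HasSum W Q) :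
    HasSum (fun i => V i + W i) (P + Q) := by
  rw [WithPiTopology.hasSum_iff_hasSum_coeff] at h h' ⊢
  intro k
  simpa using (h k).add (h' k)

lemma C_inv_mul_ofNat (n : ℕ) [n.AtLeastTwo] :
    (C (1 / (OfNat.ofNat n : ℝ)) : ℝ⟦X⟧) * OfNat.ofNat n = 1 := by
  rw [← map_ofNat (C (R := ℝ)) n, ← map_mul,
    one_div_mul_cancel (OfNat.ofNat_ne_zero n), map_one]

/-- Power sums of a family closed under `θ V = V + V²` are determined by the first one. -/
lemma hasSum_powers {ι : Type*} {V : ι → ℝ⟦X⟧} {P : ℝ⟦X⟧}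
    (hV : ∀ i, eulerOp (V i) = V i + V i ^ 2) (h : HasSum V P) :
    ∃ P₂ P₃ P₄ : ℝ⟦X⟧, HasSum (fun i => V i ^ 2) P₂ ∧ HasSum (fun i => V i ^ 3) P₃ ∧
      HasSum (fun i => V i ^ 4) P₄ ∧ P₂ = eulerOp P - P ∧ 2 * P₃ = eulerOp P₂ - 2 * P₂ ∧
      3 * P₄ = eulerOp P₃ - 3 * P₃ := by
  -- The hypothesis gives θ(V^k) = k(V^k + V^(k+1)), which is solved for V^(k+1) with k = 1, 2, 3.
  have h2 : HasSum (fun i => V i ^ 2) (eulerOp P + C (-1) * P) := by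
    convert hasSum_add (hasSum_eulerOp h) (hasSum_C_mul (-1) h) using 2 with i
    rw [hV, map_neg, map_one]; ring
  have h3 : HasSum (fun i => V i ^ 3) (C (1 / 2) * eulerOp (eulerOp P + C (-1) * P)
      + C (-1) * (eulerOp P + C (-1) * P)) := by
    convert hasSum_add (hasSum_C_mul (1 / 2) (hasSum_eulerOp h2)) (hasSum_C_mul (-1) h2)
      using 2 with i
    rw [pow_two, eulerOp_mul, hV, map_neg, map_one]
    linear_combination -(V i ^ 2 + V i ^ 3) * C_inv_mul_ofNat 2
  have h4 := hasSum_add (hasSum_C_mul (1 / 3) (hasSum_eulerOp h3)) (hasSum_C_mul (-1) h3)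
  have e4 : (fun i => C (1 / 3) * eulerOp (V i ^ 3) + C (-1) * V i ^ 3) = fun i => V i ^ 4 := by
    funext i
    rw [pow_succ _ 2, pow_two, eulerOp_mul, eulerOp_mul, hV, map_neg, map_one]
    linear_combination (V i ^ 3 + V i ^ 4) * C_inv_mul_ofNat 3
  rw [e4] at h4
  refine ⟨_, _, _, h2, h3, h4, ?_, ?_, ?_⟩
  · rw [map_neg, map_one]; ring
  · rw [map_neg, map_one]
    linear_combination eulerOp (eulerOp P + (-1) * P) * C_inv_mul_ofNat 2
  · generalize (C (1 / 2) * eulerOp (eulerOp P + C (-1) * P) + C (-1) * (eulerOp P + C (-1) * P))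
      = Q
    rw [map_neg, map_one]
    linear_combination eulerOp Q * C_inv_mul_ofNat 3

/-- `∑ k ≥ 1, X^k / m^(2k)` if `m` is even, and `0` otherwise. -/
noncomputable def evenTerm (m : ℕ) : ℝ⟦X⟧ := geomTerm (if Even m then 1 / (m : ℝ) ^ 2 else 0)

/-- `∑ k ≥ 1, X^k / m^(2k)` if `m` is odd, and `0` otherwise. -/
noncomputable def oddTerm (m : ℕ) : ℝ⟦X⟧ := geomTerm (if Even m then 0 else 1 / (m : ℝ) ^ 2)

lemma evenTerm_mul_oddTerm (m : ℕ) : evenTerm m * oddTerm m = 0 := by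
  rw [evenTerm, oddTerm]
  split_ifs <;> simp [geomTerm_zero]

/-- Since 1/0 = 0, the index 0 contributes nothing, and sums over ℕ are sums over m ≥ 1. -/
lemma evenTerm_zero : evenTerm 0 = 0 := by simp [evenTerm, geomTerm_zero]

lemma oddTerm_zero : oddTerm 0 = 0 := by simp [oddTerm, geomTerm_zero]

lemma hasSum_evenTerm : HasSum evenTerm (C (1 / 2) * (1 - cotSeries)) := by
  rw [WithPiTopology.hasSum_iff_hasSum_coeff]
  intro k
  rcases eq_or_ne k 0 with rfl | hk
  · simp [evenTerm, geomTerm, constantCoeff_cotSeries, hasSum_zero]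
  · have h := (hasSum_inv_even_pow k hk).mul_left (1 / 4 ^ k)
    have hinj : Function.Injective fun m : ℕ => 2 * m := fun a b => by simp
    have hsupp : ∀ m ∉ Set.range (fun m : ℕ => 2 * m), coeff k (evenTerm m) = 0 := by
      intro m hm
      have : ¬ Even m := fun ⟨r, hr⟩ => hm ⟨r, by simp [hr, two_mul]⟩
      simp [evenTerm, coeff_geomTerm, this, hk]
    rw [← hinj.hasSum_iff hsupp]
    have e1 : (fun m => coeff k (evenTerm m)) ∘ (fun m : ℕ => 2 * m)
        = fun m : ℕ => 1 / 4 ^ k * (1 / (m : ℝ) ^ (2 * k)) := by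
      funext m
      simp only [Function.comp, evenTerm, coeff_geomTerm, if_neg hk, even_two_mul, if_true]
      rw [one_div_pow, ← pow_mul]
      push_cast
      rw [mul_pow, pow_mul 2 2 k, div_mul_div_comm]
      norm_num
    have e2 : coeff k (C (1 / 2) * (1 - cotSeries))
        = 1 / 4 ^ k * (-(4 ^ k * coeff k cotSeries) / 2) := by
      rw [coeff_C_mul, map_sub, coeff_one, if_neg hk]
      field_simp
      ring
    rw [e1, e2]
    exact h

lemma hasSum_evenTerm_add_oddTerm :
    HasSum (fun m => evenTerm m + oddTerm m) (C (1 / 2) * (1 - rescale 4 cotSeries)) := by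
  rw [WithPiTopology.hasSum_iff_hasSum_coeff]
  intro k
  rcases eq_or_ne k 0 with rfl | hk
  · have h0 : coeff 0 (rescale 4 cotSeries) = 1 := by
      rw [coeff_rescale, pow_zero, one_mul, coeff_zero_eq_constantCoeff_apply,
        constantCoeff_cotSeries]
    rw [coeff_C_mul, map_sub, h0]
    simp [evenTerm, oddTerm, geomTerm, hasSum_zero]
  · have e1 : (fun m => coeff k (evenTerm m + oddTerm m))
        = fun m : ℕ => 1 / (m : ℝ) ^ (2 * k) := by
      funext m
      rw [map_add, evenTerm, oddTerm, coeff_geomTerm, coeff_geomTerm, if_neg hk, if_neg hk]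
      split_ifs <;> simp [hk, pow_mul]
    have e2 : coeff k (C (1 / 2) * (1 - rescale 4 cotSeries))
        = -(4 ^ k * coeff k cotSeries) / 2 := by
      rw [coeff_C_mul, map_sub, coeff_one, if_neg hk, coeff_rescale]; ring
    rw [e1, e2]
    exact hasSum_inv_even_pow k hk

lemma hasSum_oddTerm : HasSum oddTerm (C (1 / 2) * tanSeries) := by
  convert hasSum_add hasSum_evenTerm_add_oddTerm (hasSum_C_mul (-1) hasSum_evenTerm) using 2 with m
  · rw [map_neg, map_one]; ring
  · rw [tanSeries, map_neg, map_one]; ring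

lemma eulerOp_natCast_mul (n : ℕ) (f : ℝ⟦X⟧) : eulerOp (n * f) = n * eulerOp f := by
  rw [eulerOp_mul, Derivation.map_natCast]; ring

lemma eulerOp_ofNat_mul (n : ℕ) [n.AtLeastTwo] (f : ℝ⟦X⟧) :
    eulerOp (OfNat.ofNat n * f) = OfNat.ofNat n * eulerOp f :=
  eulerOp_natCast_mul n f

lemma eulerOp_ofNat (n : ℕ) [n.AtLeastTwo] : eulerOp (ofNat(n) : ℝ⟦X⟧) = 0 :=
  Derivation.map_natCast eulerOp n

/-- Power sums of the even terms as polynomials in the cotangent series (scaled to have integer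
coefficients). -/
lemma hasSum_evenTerm_powers : ∃ P₂ P₃ P₄ : ℝ⟦X⟧, HasSum (fun m => evenTerm m ^ 2) P₂ ∧
    HasSum (fun m => evenTerm m ^ 3) P₃ ∧ HasSum (fun m => evenTerm m ^ 4) P₄ ∧
    4 * P₂ = cotSeries ^ 2 + cotSeries + quarterPiSq - 2 ∧
    16 * P₃ = -2 * cotSeries ^ 3 - 3 * cotSeries ^ 2 - 2 * cotSeries * quarterPiSq
      - 3 * cotSeries - 3 * quarterPiSq + 8 ∧
    96 * P₄ = 6 * cotSeries ^ 4 + 12 * cotSeries ^ 3 + 8 * cotSeries ^ 2 * quarterPiSq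
      + 15 * cotSeries ^ 2 + 12 * cotSeries * quarterPiSq + 15 * cotSeries
      + 2 * quarterPiSq ^ 2 + 15 * quarterPiSq - 48 := by
  obtain ⟨P₂, P₃, P₄, h2, h3, h4, e2, e3, e4⟩ :=
    hasSum_powers (fun m => eulerOp_geomTerm _) hasSum_evenTerm
  have hu := eulerOp_quarterPiSq
  have hf := eulerOp_cotSeries
  set f := cotSeries
  set u := quarterPiSq
  set P := C (1 / 2) * (1 - f)
  have e1 : 2 * P = 1 - f := by linear_combination (1 - f) * C_inv_mul_ofNat 2
  have d1 := congrArg eulerOp e1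
  rw [eulerOp_ofNat_mul, map_sub, Derivation.map_one_eq_zero] at d1
  have q2 : 4 * P₂ = f ^ 2 + f + u - 2 := by
    rw [e2]; linear_combination 2 * d1 - 2 * e1 - hf
  have d2 := congrArg eulerOp q2
  simp only [map_sub, map_add, pow_two, eulerOp_mul, eulerOp_ofNat] at d2
  -- The multiplier 2f + 1 is the derivative of f² + f in f: `hf` replaces the θf produced by
  -- differentiating `q2`, and `hu` replaces θu.
  have q3 : 16 * P₃ = -2 * f ^ 3 - 3 * f ^ 2 - 2 * f * u - 3 * f - 3 * u + 8 := by
    linear_combination 8 * e3 + 2 * d2 - 4 * q2 + (2 * f + 1) * hf + 2 * hu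
  have d3 := congrArg eulerOp q3
  simp only [map_sub, map_add, map_neg, pow_succ, pow_zero, one_mul, eulerOp_mul,
    eulerOp_ofNat] at d3
  refine ⟨P₂, P₃, P₄, h2, h3, h4, q2, q3, ?_⟩
  linear_combination 32 * e4 + 2 * d3 - 6 * q3 - (6 * f ^ 2 + 6 * f + 2 * u + 3) * hf
    - 2 * (2 * f + 3) * hu

/-- Power sums of the odd terms as polynomials in the tangent series (scaled to have integer
coefficients). -/
lemma hasSum_oddTerm_powers : ∃ P₂ P₃ P₄ : ℝ⟦X⟧, HasSum (fun m => oddTerm m ^ 2) P₂ ∧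
    HasSum (fun m => oddTerm m ^ 3) P₃ ∧ HasSum (fun m => oddTerm m ^ 4) P₄ ∧
    4 * P₂ = tanSeries ^ 2 - tanSeries + quarterPiSq ∧
    16 * P₃ = 2 * tanSeries ^ 3 - 3 * tanSeries ^ 2 + 2 * tanSeries * quarterPiSq
      + 3 * tanSeries - 3 * quarterPiSq ∧
    96 * P₄ = 6 * tanSeries ^ 4 - 12 * tanSeries ^ 3 + 8 * tanSeries ^ 2 * quarterPiSq
      + 15 * tanSeries ^ 2 - 12 * tanSeries * quarterPiSq - 15 * tanSeries
      + 2 * quarterPiSq ^ 2 + 15 * quarterPiSq := by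
  obtain ⟨P₂, P₃, P₄, h2, h3, h4, e2, e3, e4⟩ :=
    hasSum_powers (fun m => eulerOp_geomTerm _) hasSum_oddTerm
  have hu := eulerOp_quarterPiSq
  have hg := eulerOp_tanSeries
  set g := tanSeries
  set u := quarterPiSq
  set P := C (1 / 2) * g
  have e1 : 2 * P = g := by linear_combination g * C_inv_mul_ofNat 2
  have d1 := congrArg eulerOp e1
  rw [eulerOp_ofNat_mul] at d1
  have q2 : 4 * P₂ = g ^ 2 - g + u := by
    rw [e2]; linear_combination 2 * d1 - 2 * e1 + hg
  have d2 := congrArg eulerOp q2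
  simp only [map_sub, map_add, pow_two, eulerOp_mul, eulerOp_ofNat] at d2
  have q3 : 16 * P₃ = 2 * g ^ 3 - 3 * g ^ 2 + 2 * g * u + 3 * g - 3 * u := by
    linear_combination 8 * e3 + 2 * d2 - 4 * q2 + (2 * g - 1) * hg + 2 * hu
  have d3 := congrArg eulerOp q3
  simp only [map_sub, map_add, pow_succ, pow_zero, one_mul, eulerOp_mul,
    eulerOp_ofNat] at d3
  refine ⟨P₂, P₃, P₄, h2, h3, h4, q2, q3, ?_⟩
  linear_combination 32 * e4 + 2 * d3 - 6 * q3 + (6 * g ^ 2 - 6 * g + 2 * u + 3) * hg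
    + 2 * (2 * g - 3) * hu

/-! ### Sign-weighted terms and Newton's formula. -/

/-- The term `∑ k ≥ 1, (1 + w (-1)^m) X^k / m^(2k)`. -/
noncomputable def weightedTerm (w : ℝ) (m : ℕ) : ℝ⟦X⟧ :=
  C (1 + w) * evenTerm m + C (1 - w) * oddTerm m

lemma weightedTerm_zero (w : ℝ) : weightedTerm w 0 = 0 := by
  rw [weightedTerm, evenTerm_zero, oddTerm_zero, mul_zero, mul_zero, add_zero]

lemma coeff_weightedTerm (w : ℝ) (m k : ℕ) :
    coeff k (weightedTerm w m) =
      if k = 0 then 0 else (1 + w * (-1) ^ m) * (1 / (m : ℝ) ^ (2 * k)) := by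
  rw [weightedTerm, map_add, coeff_C_mul, coeff_C_mul, evenTerm, oddTerm, coeff_geomTerm,
    coeff_geomTerm]
  split_ifs with h hm
  · simp
  · simp [h, hm, pow_mul]
  · simp [h, Nat.not_even_iff_odd.mp hm, pow_mul, sub_eq_add_neg]

/-- For each m the even or the odd term vanishes, so there are no cross terms. -/
lemma weightedTerm_pow (w : ℝ) (m k : ℕ) (hk : k ≠ 0) : weightedTerm w m ^ k
    = C ((1 + w) ^ k) * evenTerm m ^ k + C ((1 - w) ^ k) * oddTerm m ^ k := by
  rw [weightedTerm, map_pow, map_pow, ← mul_pow, ← mul_pow]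
  rcases mul_eq_zero.mp (evenTerm_mul_oddTerm m) with h | h <;> simp [h, hk]

lemma hasSum_weightedTerm_pow (w : ℝ) {k : ℕ} (hk : k ≠ 0) {P Q : ℝ⟦X⟧}
    (hP : HasSum (fun m => evenTerm m ^ k) P) (hQ : HasSum (fun m => oddTerm m ^ k) Q) :
    HasSum (fun m => weightedTerm w m ^ k) (C ((1 + w) ^ k) * P + C ((1 - w) ^ k) * Q) := by
  simp only [weightedTerm_pow w _ k hk]
  exact hasSum_add (hasSum_C_mul _ hP) (hasSum_C_mul _ hQ)

/-- Elementary symmetric sums over a finite set. -/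
def esymmSum {ι R : Type*} [CommRing R] (F : ι → R) (s : Finset ι) (k : ℕ) : R :=
  ∑ t ∈ s.powersetCard k, ∏ i ∈ t, F i

lemma esymmSum_zero {ι R : Type*} [CommRing R] (F : ι → R) (s : Finset ι) :
    esymmSum F s 0 = 1 := by simp [esymmSum]

lemma esymmSum_insert {ι R : Type*} [CommRing R] [DecidableEq ι] (F : ι → R) {s : Finset ι}
    {x : ι} (hx : x ∉ s) (k : ℕ) :
    esymmSum F (insert x s) (k + 1) = esymmSum F s (k + 1) + F x * esymmSum F s k := by
  rw [esymmSum, Finset.powersetCard_succ_insert hx, Finset.sum_union, Finset.sum_image]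
  · rw [esymmSum, esymmSum, Finset.mul_sum]
    congr 1
    refine Finset.sum_congr rfl fun t ht => ?_
    rw [Finset.prod_insert fun h => hx ((Finset.mem_powersetCard.mp ht).1 h)]
  · intro t ht t' ht' h
    have h1 : x ∉ t := fun h => hx ((Finset.mem_powersetCard.mp ht).1 h)
    have h2 : x ∉ t' := fun h => hx ((Finset.mem_powersetCard.mp ht').1 h)
    rw [← Finset.erase_insert h1, h, Finset.erase_insert h2]
  · rw [Finset.disjoint_left]
    intro t ht ht'
    obtain ⟨r, -, rfl⟩ := Finset.mem_image.mp ht'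
    exact hx ((Finset.mem_powersetCard.mp ht).1 (Finset.mem_insert_self x r))

/-- Newton's formula for the fourth elementary symmetric sum. -/
lemma esymmSum_four {ι R : Type*} [CommRing R] [DecidableEq ι] (F : ι → R) (s : Finset ι) :
    24 * esymmSum F s 4 = (∑ i ∈ s, F i) ^ 4 - 6 * (∑ i ∈ s, F i) ^ 2 * ∑ i ∈ s, F i ^ 2
      + 3 * (∑ i ∈ s, F i ^ 2) ^ 2 + 8 * (∑ i ∈ s, F i) * ∑ i ∈ s, F i ^ 3
      - 6 * ∑ i ∈ s, F i ^ 4 := by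
  -- Adjoining x changes e_k by F x · e_(k-1), so the induction must carry e₁, …, e₄ together.
  suffices h : esymmSum F s 1 = ∑ i ∈ s, F i ∧
      2 * esymmSum F s 2 = (∑ i ∈ s, F i) ^ 2 - ∑ i ∈ s, F i ^ 2 ∧
      6 * esymmSum F s 3 = (∑ i ∈ s, F i) ^ 3 - 3 * (∑ i ∈ s, F i) * ∑ i ∈ s, F i ^ 2
        + 2 * ∑ i ∈ s, F i ^ 3 ∧
      24 * esymmSum F s 4 = (∑ i ∈ s, F i) ^ 4 - 6 * (∑ i ∈ s, F i) ^ 2 * ∑ i ∈ s, F i ^ 2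
        + 3 * (∑ i ∈ s, F i ^ 2) ^ 2 + 8 * (∑ i ∈ s, F i) * ∑ i ∈ s, F i ^ 3
        - 6 * ∑ i ∈ s, F i ^ 4 from h.2.2.2
  induction s using Finset.induction_on with
  | empty =>
    have h : ∀ k, esymmSum F ∅ (k + 1) = 0 := fun k => by
      rw [esymmSum, Finset.powersetCard_eq_empty.mpr (by simp), Finset.sum_empty]
    simp [h 0, h 1, h 2, h 3]
  | insert x s hx ih =>
    obtain ⟨h1, h2, h3, h4⟩ := ih
    have e1 := esymmSum_insert F hx 0
    have e2 := esymmSum_insert F hx 1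
    have e3 := esymmSum_insert F hx 2
    have e4 := esymmSum_insert F hx 3
    rw [esymmSum_zero] at e1
    norm_num only at e1 e2 e3 e4
    simp only [Finset.sum_insert hx]
    refine ⟨?_, ?_, ?_, ?_⟩
    · linear_combination e1 + h1
    · linear_combination 2 * e2 + h2 + 2 * F x * h1
    · linear_combination 6 * e3 + h3 + 3 * F x * h2
    · linear_combination 24 * e4 + h4 + 4 * F x * h3

/-- The fourth elementary symmetric sums of the weighted terms converge, and the limit is linear
in the cotangent and tangent series. -/
lemma tendsto_esymmSum_weightedTerm (w : ℝ) : ∃ e : ℝ⟦X⟧,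
    Tendsto (fun s : Finset ℕ => 24 * esymmSum (weightedTerm w) s 4) atTop (𝓝 e) ∧
    96 * e = 6 * (
      (105 - 180 * quarterPiSq + 16 * quarterPiSq ^ 2 + 105 * tanSeries
        - 40 * quarterPiSq * tanSeries - 105 * cotSeries + 40 * quarterPiSq * cotSeries)
      + C w * (420 - 192 * quarterPiSq + 36 * tanSeries - 16 * quarterPiSq * tanSeries
        - 420 * cotSeries + 16 * quarterPiSq * cotSeries)
      + C w ^ 2 * (630 - 288 * quarterPiSq + 54 * tanSeries - 24 * quarterPiSq * tanSeries
        - 630 * cotSeries + 24 * quarterPiSq * cotSeries)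
      + C w ^ 3 * (420 - 48 * quarterPiSq - 156 * tanSeries + 64 * quarterPiSq * tanSeries
        - 420 * cotSeries + 64 * quarterPiSq * cotSeries)
      + C w ^ 4 * (105 - 12 * quarterPiSq - 39 * tanSeries + 16 * quarterPiSq * tanSeries
        - 105 * cotSeries + 16 * quarterPiSq * cotSeries)) := by
  obtain ⟨P₂, P₃, P₄, hP2, hP3, hP4, p2, p3, p4⟩ := hasSum_evenTerm_powers
  obtain ⟨Q₂, Q₃, Q₄, hQ2, hQ3, hQ4, q2, q3, q4⟩ := hasSum_oddTerm_powers
  have h1 : HasSum (weightedTerm w) _ :=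
    hasSum_add (hasSum_C_mul (1 + w) hasSum_evenTerm) (hasSum_C_mul (1 - w) hasSum_oddTerm)
  have h2 := hasSum_weightedTerm_pow w two_ne_zero hP2 hQ2
  have h3 := hasSum_weightedTerm_pow w three_ne_zero hP3 hQ3
  have h4 := hasSum_weightedTerm_pow w four_ne_zero hP4 hQ4
  have p1 : 2 * (C (1 / 2) * (1 - cotSeries)) = 1 - cotSeries := by
    linear_combination (1 - cotSeries) * C_inv_mul_ofNat 2
  have q1 : 2 * (C (1 / 2) * tanSeries) = tanSeries := by
    linear_combination tanSeries * C_inv_mul_ofNat 2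
  have hfg := cotSeries_mul_tanSeries
  rw [HasSum, SummationFilter.unconditional_filter] at h1 h2 h3 h4
  simp only [esymmSum_four]
  refine ⟨_, ((((h1.pow 4).sub (((h1.pow 2).const_mul 6).mul h2)).add
    ((h2.pow 2).const_mul 3)).add ((h1.const_mul 8).mul h3)).sub (h4.const_mul 6), ?_⟩
  simp only [map_pow, map_add, map_sub, map_one]
  generalize C (1 / 2) * (1 - cotSeries) = P₁ at *
  generalize C (1 / 2) * tanSeries = Q₁ at *
  generalize (C w : ℝ⟦X⟧) = W at *
  set f := cotSeries
  set g := tanSeries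
  set u := quarterPiSq
  set a := 1 + W with ha
  set b := 1 - W with hb
  have r1 : 2 * (a * P₁ + b * Q₁) = a * (1 - f) + b * g := by
    linear_combination a * p1 + b * q1
  have r2 : 4 * (a ^ 2 * P₂ + b ^ 2 * Q₂)
      = a ^ 2 * (f ^ 2 + f + u - 2) + b ^ 2 * (g ^ 2 - g + u) := by
    linear_combination a ^ 2 * p2 + b ^ 2 * q2
  have r3 : 16 * (a ^ 3 * P₃ + b ^ 3 * Q₃)
      = a ^ 3 * (-2 * f ^ 3 - 3 * f ^ 2 - 2 * f * u - 3 * f - 3 * u + 8)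
        + b ^ 3 * (2 * g ^ 3 - 3 * g ^ 2 + 2 * g * u + 3 * g - 3 * u) := by
    linear_combination a ^ 3 * p3 + b ^ 3 * q3
  have r4 : 96 * (a ^ 4 * P₄ + b ^ 4 * Q₄)
      = a ^ 4 * (6 * f ^ 4 + 12 * f ^ 3 + 8 * f ^ 2 * u + 15 * f ^ 2 + 12 * f * u + 15 * f
          + 2 * u ^ 2 + 15 * u - 48)
        + b ^ 4 * (6 * g ^ 4 - 12 * g ^ 3 + 8 * g ^ 2 * u + 15 * g ^ 2 - 12 * g * u - 15 * g
          + 2 * u ^ 2 + 15 * u) := by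
    linear_combination a ^ 4 * p4 + b ^ 4 * q4
  generalize a * P₁ + b * Q₁ = S₁ at *
  generalize a ^ 2 * P₂ + b ^ 2 * Q₂ = S₂ at *
  generalize a ^ 3 * P₃ + b ^ 3 * Q₃ = S₃ at *
  generalize a ^ 4 * P₄ + b ^ 4 * Q₄ = S₄ at *
  -- The factor 96 clears the denominators 2, 4, 16, 96 of the four power sums.
  have key : 96 * (S₁ ^ 4 - 6 * S₁ ^ 2 * S₂ + 3 * S₂ ^ 2 + 8 * S₁ * S₃ - 6 * S₄)
      = 6 * (2 * S₁) ^ 4 - 36 * (2 * S₁) ^ 2 * (4 * S₂) + 18 * (4 * S₂) ^ 2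
        + 24 * (2 * S₁) * (16 * S₃) - 6 * (96 * S₄) := by ring
  rw [key, r1, r2, r3, r4, ha, hb]
  -- Pure powers of f and g above the first cancel identically; fg = u is needed only for the mixed
  -- terms.
  linear_combination ((1 + W) * (1 - W) ^ 3 * (24 * u - 72) - 108 * (1 + W) ^ 2 * (1 - W) ^ 2
    + (1 + W) ^ 3 * (1 - W) * (24 * u - 360)) * hfg

/-! ### Depth-one values. -/

lemma eulerSum_fin_one {s : ℕ} (hs : s ≠ 0) (ε : ℤˣ) {A : ℝ}
    (h : HasSum (fun m : ℕ => ((ε : ℤ) : ℝ) ^ m / (m : ℝ) ^ s) A) :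
    eulerSum (fun _ : Fin 1 => s) (fun _ => ε) = A := by
  have hinj : Function.Injective fun m : DecreasingTuple 1 => m.1 0 := fun a b hab =>
    Subtype.ext (funext fun i => by rw [Subsingleton.elim i 0]; exact hab)
  have hsupp : ∀ m ∉ Set.range (fun m : DecreasingTuple 1 => m.1 0),
      ((ε : ℤ) : ℝ) ^ m / (m : ℝ) ^ s = 0 := by
    intro m hm
    rcases Nat.eq_zero_or_pos m with rfl | hpos
    · simp [hs]
    · exact absurd ⟨⟨fun _ => m, Subsingleton.strictAnti _, fun _ => hpos⟩, rfl⟩ hm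
  rw [← hinj.hasSum_iff hsupp] at h
  rw [eulerSum, ← h.tsum_eq]
  exact tsum_congr fun m => by simp [eulerTerm]

lemma zetaVal_two_mul {k : ℕ} (hk : k ≠ 0) :
    zetaVal (2 * k) = -(4 ^ k * coeff k cotSeries) / 2 := by
  refine eulerSum_fin_one (by omega) 1 ?_
  simpa using hasSum_inv_even_pow k hk

lemma zetaVal_two : zetaVal 2 = Real.pi ^ 2 / 6 :=
  eulerSum_fin_one two_ne_zero 1 (by simpa using hasSum_zeta_two)

lemma zetaBar_two_mul {k : ℕ} (hk : k ≠ 0) :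
    zetaBar (2 * k) = -coeff k cotSeries + 4 ^ k * coeff k cotSeries / 2 := by
  refine eulerSum_fin_one (by omega) (-1) ?_
  have hE := (WithPiTopology.hasSum_iff_hasSum_coeff (R := ℝ)).mp hasSum_evenTerm k
  have hO := (WithPiTopology.hasSum_iff_hasSum_coeff (R := ℝ)).mp hasSum_oddTerm k
  have e1 : (fun m : ℕ => (((-1 : ℤˣ) : ℤ) : ℝ) ^ m / (m : ℝ) ^ (2 * k))
      = fun m => coeff k (evenTerm m) - coeff k (oddTerm m) := by
    funext m
    rw [evenTerm, oddTerm, coeff_geomTerm, coeff_geomTerm, if_neg hk, if_neg hk]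
    split_ifs with hm
    · simp [hk, hm, pow_mul]
    · simp [hk, Nat.not_even_iff_odd.mp hm, pow_mul, neg_div]
  have e2 : -coeff k cotSeries + 4 ^ k * coeff k cotSeries / 2
      = coeff k (C (1 / 2) * (1 - cotSeries)) - coeff k (C (1 / 2) * tanSeries) := by
    rw [coeff_C_mul, coeff_C_mul, tanSeries, map_sub, map_sub, coeff_rescale, coeff_one, if_neg hk]
    ring
  rw [e1, e2]
  exact hE.sub hO

/-! ### From Euler sums to elementary symmetric sums. -/

lemma coeff_prod_fin {d : ℕ} (G : Fin d → ℝ⟦X⟧) (n : ℕ) :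
    coeff n (∏ i, G i) = ∑ j ∈ Finset.Nat.antidiagonalTuple d n, ∏ i, coeff (j i) (G i) := by
  rw [coeff_prod]
  refine Finset.sum_bij' (fun l _ => ⇑l) (fun j _ => Finsupp.equivFunOnFinite.symm j)
    ?_ ?_ ?_ ?_ ?_
  · intro l hl
    rw [Finset.Nat.mem_antidiagonalTuple]
    exact (Finset.mem_finsuppAntidiag.mp hl).1
  · intro j hj
    rw [Finset.mem_finsuppAntidiag]
    exact ⟨Finset.Nat.mem_antidiagonalTuple.mp hj, Finset.subset_univ _⟩
  · intro l _; ext; rfl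
  · intro j _; rfl
  · intro l _; rfl

/-- Summing the weighted general terms over all sign vectors gives a product. -/
lemma sum_signs_eulerTerm (w : ℝ) {d : ℕ} (s : Fin d → ℕ) (m : DecreasingTuple d) :
    ∑ ε : Fin d → ℤˣ, w ^ (Finset.univ.filter fun i => ε i = -1).card * eulerTerm s ε m
      = ∏ i, (1 + w * (-1) ^ m.1 i) * (1 / (m.1 i : ℝ) ^ s i) := by
  have h : ∀ i, (1 + w * (-1) ^ m.1 i) * (1 / (m.1 i : ℝ) ^ s i)
      = ∑ e : ℤˣ, (if e = -1 then w else 1) * (((e : ℤ) : ℝ) ^ m.1 i / (m.1 i : ℝ) ^ s i) := by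
    intro i
    have h1 : (1 : ℤˣ) ≠ -1 := by decide
    rw [UnitsInt.univ, Finset.sum_pair h1, if_neg h1, if_pos rfl]
    push_cast
    rw [one_pow]
    ring
  simp only [h]
  rw [Fintype.prod_sum]
  refine Finset.sum_congr rfl fun ε _ => ?_
  rw [Finset.prod_mul_distrib, Finset.prod_ite, Finset.prod_const, Finset.prod_const_one, mul_one,
    eulerTerm]

lemma sum_pow_mul_restrictedSum (w : ℝ) (n d : ℕ) :
    ∑ α ∈ Finset.range (d + 1), w ^ α * restrictedSum α n d
      = ∑ j ∈ positiveTuples n d, ∑ ε : Fin d → ℤˣ,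
          w ^ (Finset.univ.filter fun i => ε i = -1).card * eulerSum (fun i => 2 * j i) ε := by
  simp only [restrictedSum, Finset.mul_sum]
  rw [Finset.sum_comm]
  refine Finset.sum_congr rfl fun j _ => ?_
  rw [← Finset.sum_fiberwise_of_maps_to (s := Finset.univ) (t := Finset.range (d + 1))
    (g := fun ε : Fin d → ℤˣ => (Finset.univ.filter fun i => ε i = -1).card)]
  · refine Finset.sum_congr rfl fun α _ => Finset.sum_congr rfl fun ε hε => ?_
    rw [(Finset.mem_filter.mp hε).2]
  · intro ε _
    have := Finset.card_filter_le (Finset.univ : Finset (Fin d)) fun i => ε i = -1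
    rw [Finset.card_fin] at this
    exact Finset.mem_range.mpr (by omega)

/-- The weighted terms have no constant coefficient, so only positive exponents j_i survive; the
remaining finite sums commute with the absolutely convergent sum over tuples. -/
lemma hasSum_coeff_prod_weightedTerm (w : ℝ) (n d : ℕ) :
    HasSum (fun m : DecreasingTuple d => coeff n (∏ i, weightedTerm w (m.1 i)))
      (∑ α ∈ Finset.range (d + 1), w ^ α * restrictedSum α n d) := by
  rw [sum_pow_mul_restrictedSum]
  have e : (fun m : DecreasingTuple d => coeff n (∏ i, weightedTerm w (m.1 i)))
      = fun m => ∑ j ∈ positiveTuples n d, ∑ ε : Fin d → ℤˣ,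
          w ^ (Finset.univ.filter fun i => ε i = -1).card * eulerTerm (fun i => 2 * j i) ε m := by
    funext m
    simp only [sum_signs_eulerTerm]
    rw [coeff_prod_fin, positiveTuples]
    refine (Finset.sum_subset (Finset.filter_subset _ _) fun j hj hj' => ?_).symm.trans
      (Finset.sum_congr rfl fun j hj => Finset.prod_congr rfl fun i _ => ?_)
    · obtain ⟨i, hi⟩ : ∃ i, j i = 0 := by
        by_contra! h
        exact hj' (Finset.mem_filter.mpr ⟨hj, fun i => Nat.pos_of_ne_zero (h i)⟩)
      exact Finset.prod_eq_zero (Finset.mem_univ i) (by rw [coeff_weightedTerm, if_pos hi])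
    · rw [coeff_weightedTerm, if_neg ((Finset.mem_filter.mp hj).2 i).ne']
  rw [e]
  refine hasSum_sum fun j hj => hasSum_sum fun ε _ => HasSum.mul_left _ ?_
  refine (summable_eulerTerm _ ε fun i => ?_).hasSum
  have := (Finset.mem_filter.mp hj).2 i
  omega

/-- Sums over decreasing tuples with entries in a finite set are elementary symmetric sums. -/
lemma sum_decreasingTuple_eq_esymmSum {R : Type*} [CommRing R] (F : ℕ → R) (h0 : F 0 = 0)
    (s : Finset ℕ) (d : ℕ) :
    ∑ m ∈ (Fintype.piFinset fun _ : Fin d => s).preimage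
        (Subtype.val : DecreasingTuple d → Fin d → ℕ) Subtype.val_injective.injOn, ∏ i, F (m.1 i)
      = esymmSum F s d := by
  refine Finset.sum_of_injOn (fun m => Finset.univ.image m.1) ?_ ?_ ?_ ?_
  · intro m _ m' _ h
    apply Subtype.ext
    rw [← StrictAnti.range_inj m.2.1 m'.2.1, ← Set.image_univ, ← Set.image_univ]
    simpa using congrArg (fun t : Finset ℕ => (t : Set ℕ)) h
  · intro m hm
    have hm' : ∀ i, m.1 i ∈ s := by simpa using hm
    rw [Finset.mem_coe, Finset.mem_powersetCard]
    refine ⟨?_, ?_⟩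
    · intro x hx
      obtain ⟨i, -, rfl⟩ := Finset.mem_image.mp hx
      exact hm' i
    · rw [Finset.card_image_of_injective _ m.2.1.injective, Finset.card_fin]
  · intro t ht hnot
    obtain ⟨hts, htd⟩ := Finset.mem_powersetCard.mp ht
    -- A subset containing 0 comes from no tuple, but its product vanishes because F 0 = 0.
    by_cases h : 0 ∈ t
    · exact Finset.prod_eq_zero h h0
    refine absurd ?_ hnot
    have himg : Finset.univ.image (fun i => t.orderEmbOfFin htd (Fin.rev i)) = t := by
      refine Eq.trans ?_ (Finset.image_orderEmbOfFin_univ t htd)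
      ext x
      simp only [Finset.mem_image, Finset.mem_univ, true_and]
      exact ⟨fun ⟨i, hi⟩ => ⟨Fin.rev i, hi⟩, fun ⟨i, hi⟩ => ⟨Fin.rev i, by rwa [Fin.rev_rev]⟩⟩
    have hmem : ∀ i, t.orderEmbOfFin htd (Fin.rev i) ∈ t :=
      fun i => Finset.orderEmbOfFin_mem t htd _
    refine ⟨⟨fun i => t.orderEmbOfFin htd (Fin.rev i), ?_, ?_⟩, ?_, himg⟩
    · exact fun i j hij => (t.orderEmbOfFin htd).strictMono (Fin.rev_lt_rev.mpr hij)
    · exact fun i => Nat.pos_of_ne_zero fun h' => h (h' ▸ hmem i)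
    · simpa using fun i => hts (hmem i)
  · intro m _
    rw [Finset.prod_image fun i _ j _ h => m.2.1.injective h]

/-- Tuples with entries in s exhaust all decreasing tuples as s grows, so unconditional summability
passes to these partial sums. -/
lemma tendsto_coeff_esymmSum_weightedTerm (w : ℝ) (n d : ℕ) :
    Tendsto (fun s : Finset ℕ => coeff n (esymmSum (weightedTerm w) s d)) atTop
      (𝓝 (∑ α ∈ Finset.range (d + 1), w ^ α * restrictedSum α n d)) := by
  have h := hasSum_coeff_prod_weightedTerm w n d
  rw [HasSum, SummationFilter.unconditional_filter] at h
  have hT : Tendsto (fun s : Finset ℕ => (Fintype.piFinset fun _ : Fin d => s).preimage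
        (Subtype.val : DecreasingTuple d → Fin d → ℕ) Subtype.val_injective.injOn) atTop atTop := by
    refine tendsto_atTop_finset_of_monotone ?_ ?_
    · intro s t hst m hm
      simp only [Finset.mem_preimage, Fintype.mem_piFinset] at hm ⊢
      exact fun i => hst (hm i)
    · intro m
      exact ⟨Finset.univ.image m.1, by simp⟩
  refine (h.comp hT).congr fun s => ?_
  rw [Function.comp, ← map_sum, sum_decreasingTuple_eq_esymmSum _ (weightedTerm_zero w)]

lemma coeff_ofNat_mul (k n : ℕ) [n.AtLeastTwo] (f : ℝ⟦X⟧) :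
    coeff k (ofNat(n) * f) = ofNat(n) * coeff k f := by
  rw [← map_ofNat (C (R := ℝ)) n, coeff_C_mul]

lemma coeff_ofNat (k n : ℕ) [n.AtLeastTwo] : coeff (k + 1) (ofNat(n) : ℝ⟦X⟧) = 0 := by
  rw [← map_ofNat (C (R := ℝ)) n, coeff_C, if_neg k.succ_ne_zero]

lemma coeff_quarterPiSq_mul (k : ℕ) (f : ℝ⟦X⟧) :
    coeff (k + 1) (quarterPiSq * f) = Real.pi ^ 2 / 4 * coeff k f := by
  rw [quarterPiSq, mul_assoc, coeff_C_mul, coeff_succ_X_mul]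

lemma coeff_quarterPiSq (k : ℕ) : coeff (k + 2) quarterPiSq = 0 := by
  rw [quarterPiSq, coeff_C_mul, coeff_X, if_neg (by omega), mul_zero]

/-! ### Extraction of the coefficients. -/

/-- The depth-four restricted sums as coefficients of the cotangent and tangent series. -/
lemma restrictedSum_four (n : ℕ) :
    384 * restrictedSum 0 n 4 = coeff n (105 - 180 * quarterPiSq + 16 * quarterPiSq ^ 2
      + 105 * tanSeries - 40 * quarterPiSq * tanSeries - 105 * cotSeries
      + 40 * quarterPiSq * cotSeries) ∧
    384 * restrictedSum 1 n 4 = coeff n (420 - 192 * quarterPiSq + 36 * tanSeries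
      - 16 * quarterPiSq * tanSeries - 420 * cotSeries + 16 * quarterPiSq * cotSeries) ∧
    384 * restrictedSum 2 n 4 = coeff n (630 - 288 * quarterPiSq + 54 * tanSeries
      - 24 * quarterPiSq * tanSeries - 630 * cotSeries + 24 * quarterPiSq * cotSeries) ∧
    384 * restrictedSum 3 n 4 = coeff n (420 - 48 * quarterPiSq - 156 * tanSeries
      + 64 * quarterPiSq * tanSeries - 420 * cotSeries + 64 * quarterPiSq * cotSeries) ∧
    384 * restrictedSum 4 n 4 = coeff n (105 - 12 * quarterPiSq - 39 * tanSeries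
      + 16 * quarterPiSq * tanSeries - 105 * cotSeries + 16 * quarterPiSq * cotSeries) := by
  choose e he h using tendsto_esymmSum_weightedTerm
  have h2 : ∀ w, coeff n (e w) = 24 * ∑ α ∈ Finset.range (4 + 1), w ^ α * restrictedSum α n 4 := by
    intro w
    have h1 := ((WithPiTopology.tendsto_iff_coeff_tendsto (R := ℝ) _ _ _).mp (he w)) n
    simp only [coeff_ofNat_mul] at h1
    exact tendsto_nhds_unique h1 ((tendsto_coeff_esymmSum_weightedTerm w n 4).const_mul 24)
  have key := fun w => congrArg (coeff n) (h w)
  simp only [← map_pow C, coeff_ofNat_mul, h2, map_add, map_sub, coeff_C_mul,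
    Finset.sum_range_succ, Finset.sum_range_zero] at key ⊢
  -- Both sides are polynomials of degree at most 4 in w; five values of w separate their
  -- coefficients.
  have k0 := key 0
  have k1 := key 1
  have k2 := key (-1)
  have k3 := key 2
  have k4 := key (-2)
  norm_num only at k0 k1 k2 k3 k4
  refine ⟨?_, ?_, ?_, ?_, ?_⟩ <;> linarith

end AlternatingEulerSum

open AlternatingEulerSum PowerSeries in
theorem mainTheorem7 (n : ℕ) :
    (2 ≤ n →
      restrictedSum 1 n 4 =
          19 / 16 * zetaVal (2 * n) + zetaBar (2 * n)
            - 1 / 8 * zetaVal 2 * zetaVal (2 * n - 2) ∧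
      restrictedSum 2 n 4 =
          57 / 32 * zetaVal (2 * n) + 3 / 2 * zetaBar (2 * n)
            - 3 / 16 * zetaVal 2 * zetaVal (2 * n - 2) ∧
      restrictedSum 3 n 4 =
          11 / 16 * zetaVal (2 * n) + 3 / 2 * zetaBar (2 * n)
            - 1 / 2 * zetaVal 2 * zetaBar (2 * n - 2) ∧
      restrictedSum 4 n 4 =
          11 / 64 * zetaVal (2 * n) + 3 / 8 * zetaBar (2 * n)
            - 1 / 8 * zetaVal 2 * zetaBar (2 * n - 2)) ∧
    (3 ≤ n →
      restrictedSumAll n 4 =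
          35 / 4 ^ (n + 1) * zetaVal (2 * n) - 5 / 4 ^ n * zetaVal 2 * zetaVal (2 * n - 2)) := by
  have hcoef := restrictedSum_four n
  have hZ : ∀ k, k ≠ 0 → zetaVal (2 * k) = _ := fun k hk => zetaVal_two_mul hk
  have hB : ∀ k, k ≠ 0 → zetaBar (2 * k) = _ := fun k hk => zetaBar_two_mul hk
  have ht : ∀ k, coeff k tanSeries = coeff k cotSeries - 4 ^ k * coeff k cotSeries := fun k => by
    rw [tanSeries, map_sub, coeff_rescale]
  constructor
  · intro hn
    obtain ⟨k, rfl⟩ := Nat.exists_eq_add_of_le' hn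
    obtain ⟨-, h1, h2, h3, h4⟩ := hcoef
    rw [show 2 * (k + 2) - 2 = 2 * (k + 1) by omega, zetaVal_two, hZ _ (by omega), hZ _ (by omega),
      hB _ (by omega), hB _ (by omega)]
    simp only [map_add, map_sub, mul_assoc, coeff_ofNat_mul, coeff_ofNat, coeff_quarterPiSq_mul,
      coeff_quarterPiSq, ht] at h1 h2 h3 h4
    refine ⟨?_, ?_, ?_, ?_⟩
    · linear_combination h1 / 384
    · linear_combination h2 / 384
    · linear_combination h3 / 384
    · linear_combination h4 / 384
  -- The term 16u² in the α = 0 sum contributes to the coefficient of X², hence n ≥ 3 here.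
  · intro hn
    obtain ⟨k, rfl⟩ := Nat.exists_eq_add_of_le' hn
    obtain ⟨h0, h1, h2, h3, h4⟩ := hcoef
    rw [show 2 * (k + 3) - 2 = 2 * (k + 2) by omega, zetaVal_two, hZ _ (by omega),
      hZ _ (by omega)]
    simp only [map_add, map_sub, mul_assoc, coeff_ofNat_mul, coeff_ofNat, coeff_quarterPiSq_mul,
      coeff_quarterPiSq, ht, pow_two quarterPiSq] at h0 h1 h2 h3 h4
    simp only [restrictedSumAll, Finset.sum_range_succ, Finset.sum_range_zero]
    have e : (4 : ℝ) ^ k ≠ 0 := by positivity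
    rw [pow_succ 4 (k + 3)]
    have e1 : 35 / ((4 : ℝ) ^ (k + 3) * 4)
        * (-(4 ^ (k + 3) * coeff (k + 3) cotSeries) / 2) = -35 / 8 * coeff (k + 3) cotSeries := by
      field_simp; ring
    have e2 : 5 / (4 : ℝ) ^ (k + 3) * (Real.pi ^ 2 / 6)
        * (-(4 ^ (k + 2) * coeff (k + 2) cotSeries) / 2)
        = -5 / 48 * Real.pi ^ 2 * coeff (k + 2) cotSeries := by
      field_simp; ring
    rw [e1, e2]
    -- Adding all α amounts to w = 1, where the odd terms have weight 0 and the tangent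
    -- contributions cancel.
    linear_combination (h0 + h1 + h2 + h3 + h4) / 384
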